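/- Let $n\ge 5$ be an integer and let $\alpha\le 2$ be a real number. Define $f_\alpha$ on $(0,\infty)$ by $f_\alpha(x)=x^\alpha$ if $\alpha>0$, $f_\alpha(x)=\ln x$ if $\alpha=0$, and $f_\alpha(x)=-x^\alpha$ if $\alpha<0$, and let $f_\alpha(0)=\lim_{x\to0^+}f_\alpha(x)$, that is, $0$ if $\alpha>0$ and $-\infty$ if $\alpha\le 0$. Let $\{\Gamma_n\}$ be the set of all convex $n$-gons in $\mathbb{R}^2$ with vertices $A_1,\dots,A_n$ in cyclic order and all edges $A_1A_2,\dots,A_{n-1}A_n,A_nA_1$ of length $1$. Here a convex $n$-gon may have straight angles, and it may be degenerate: either its vertices are not all on one line and are met in their cyclic order when the boundary of their convex hull is travelled once (in one of the two directions), or the closed polygon consists of two coinciding straight arcs joining two of its vertices (with unit edges this means that $n=2m$ and some diagonal has length $m$). Put $$E^\alpha_n(\Gamma_n)=\sum_{1\le p<q\le n} f_\alpha(|A_pA_q|).$$ Then $E^\alpha_n$ attains its maximum over the set $\{\Gamma_n\}$, and it does so at $\Gamma_n$ if and only if $\Gamma_n$ is a regular $n$-gon of edge length $1$ (that is, congruent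 to the standard one, with its vertices in consecutive order). -/

import Mathlib

/-- The Euclidean plane. -/
abbrev Plane : Type := EuclideanSpace ℝ (Fin 2)

/-- Twice the signed area of the triangle `P Q R`: nonnegative when `P, Q, R` is a (weakly)
counterclockwise turn, zero exactly when the three points are collinear. -/
def orientedArea (P Q R : Plane) : ℝ :=
  (Q 0 - P 0) * (R 1 - P 1) - (Q 1 - P 1) * (R 0 - P 0)

/-- A nondegenerate convex polygon with vertices `A 0, …, A (n - 1)` in this cyclic order: the
vertices are not all on one line, and they are met in this order when the boundary of their convex
hull is travelled once, counterclockwise (first alternative) or clockwise (second alternative).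
Straight angles are allowed, so vertices may lie inside a side of the convex hull. -/
def IsNondegenerateConvexPolygon {n : ℕ} (A : Fin n → Plane) : Prop :=
  ¬ Collinear ℝ (Set.range A) ∧
    ((∀ i j k : Fin n, i < j → j < k → 0 ≤ orientedArea (A i) (A j) (A k)) ∨
      (∀ i j k : Fin n, i < j → j < k → orientedArea (A i) (A j) (A k) ≤ 0))

/-- A degenerate convex polygon: the closed polygonal curve consists of two coinciding straight
arcs between two of its vertices `A p` and `A q`. Equivalently, its total length (`finRotate n` is
the cyclic successor `i ↦ i + 1` of indices) is twice the distance of `A p` and `A q`.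
If all edges have length 1, this says that `n = 2 m` and some diagonal has length `m`. -/
def IsDegenerateConvexPolygon {n : ℕ} (A : Fin n → Plane) : Prop :=
  ∃ p q : Fin n, ∑ i : Fin n, dist (A i) (A (finRotate n i)) = 2 * dist (A p) (A q)

/-- The set of all convex planar `n`-gons, degenerate ones included, with every edge of
length 1, given by their vertices in cyclic order. -/
def unitConvexPolygons (n : ℕ) : Set (Fin n → Plane) :=
  {A | (∀ i : Fin n, dist (A i) (A (finRotate n i)) = 1) ∧
    (IsNondegenerateConvexPolygon A ∨ IsDegenerateConvexPolygon A)}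

/-- The function `f_α` on `[0, ∞)`: it is `x ^ α` for `α > 0`, `ln x` for `α = 0` and `-x ^ α` for
`α < 0`. At `x = 0` it takes its limit value: `0` for `α > 0` and `-∞` for `α ≤ 0`. -/
noncomputable def powerPotential (α x : ℝ) : EReal :=
  if 0 < α then ((x ^ α : ℝ) : EReal)
  else if x = 0 then ⊥
  else if α = 0 then ((Real.log x : ℝ) : EReal)
  else ((-(x ^ α) : ℝ) : EReal)

/-- The power energy: the sum of `f_α (|A_p A_q|)` over all pairs `p < q`. -/
noncomputable def powerEnergy (α : ℝ) {n : ℕ} (A : Fin n → Plane) : EReal :=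
  ∑ p : Fin n, ∑ q ∈ Finset.Ioi p, powerPotential α (dist (A p) (A q))

/-- The standard regular `n`-gon with edge length 1: it is centred at the origin and has
circumradius `1 / (2 sin (π / n))`. -/
noncomputable def regularPolygon (n : ℕ) (k : Fin n) : Plane :=
  (1 / (2 * Real.sin (Real.pi / n))) •
    !₂[Real.cos (2 * Real.pi * (k : ℕ) / n), Real.sin (2 * Real.pi * (k : ℕ) / n)]

/-- `A` is a regular `n`-gon with edge length 1, that is, a congruent copy (under an isometry of
the plane) of the standard one. -/
def IsUnitRegularPolygon {n : ℕ} (A : Fin n → Plane) : Prop :=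
  ∃ τ : Plane ≃ᵢ Plane, ∀ k : Fin n, A k = τ (regularPolygon n k)

theorem powerPotential_tangent_bound {α s : ℝ} (hα : α ≤ 2) (hs : 0 < s) :
    powerPotential α s = ((powerPotential α s).toReal : EReal) ∧
      ∃ c : ℝ, 0 < c ∧ ∀ t : ℝ, 0 ≤ t →
        powerPotential α t ≤
          (((powerPotential α s).toReal + c * (t ^ 2 - s ^ 2) : ℝ) : EReal) := by
  have hs2 : 0 < s ^ 2 := by positivity
  have hsp : 0 < s ^ α := Real.rpow_pos_of_pos hs α
  have key : ∀ t : ℝ, 0 ≤ t → t ^ α = s ^ α * ((t / s) ^ 2) ^ (α / 2) := by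
    intro t ht
    have h : ((t / s) ^ 2) ^ (α / 2) = (t / s) ^ α := by
      rw [← Real.rpow_natCast, ← Real.rpow_mul (by positivity)]
      congr 1
      push_cast
      ring
    rw [h, ← Real.mul_rpow hs.le (by positivity), mul_div_cancel₀ _ hs.ne']
  have hlog : ∀ t : ℝ, 0 < t → 2 * (Real.log t - Real.log s) ≤ t ^ 2 / s ^ 2 - 1 := by
    intro t ht
    have h := Real.log_le_sub_one_of_pos (x := (t / s) ^ 2) (by positivity)
    rw [Real.log_pow, Real.log_div ht.ne' hs.ne', div_pow] at h
    exact_mod_cast h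
  rcases lt_trichotomy α 0 with h0 | h0 | h0
  · have hv : powerPotential α s = ((-(s ^ α) : ℝ) : EReal) := by
      simp [powerPotential, h0.not_gt, hs.ne', h0.ne]
    rw [hv, EReal.toReal_coe]
    refine ⟨rfl, -α / 2 * s ^ α / s ^ 2, ?_, fun t ht => ?_⟩
    · have : 0 < -α := by linarith
      positivity
    · rcases ht.eq_or_lt with rfl | ht'
      · simp [powerPotential, h0.not_gt]
      · have hb : 1 + α / 2 * (t ^ 2 / s ^ 2 - 1) ≤ ((t / s) ^ 2) ^ (α / 2) := by
          have hu : 0 < (t / s) ^ 2 := by positivity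
          have h1 := Real.add_one_le_exp (Real.log ((t / s) ^ 2) * (α / 2))
          rw [← Real.rpow_def_of_pos hu] at h1
          have h2 := Real.log_le_sub_one_of_pos hu
          rw [← div_pow]
          nlinarith
        have : powerPotential α t = ((-(t ^ α) : ℝ) : EReal) := by
          simp [powerPotential, h0.not_gt, ht'.ne', h0.ne]
        rw [this, EReal.coe_le_coe_iff, key t ht]
        have e : -α / 2 * s ^ α / s ^ 2 * (t ^ 2 - s ^ 2)
            = s ^ α * (-α / 2 * (t ^ 2 / s ^ 2 - 1)) := by field_simp
        rw [e]
        nlinarith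
  · subst h0
    have hv : powerPotential 0 s = ((Real.log s : ℝ) : EReal) := by
      simp [powerPotential, hs.ne']
    rw [hv, EReal.toReal_coe]
    refine ⟨rfl, 1 / (2 * s ^ 2), by positivity, fun t ht => ?_⟩
    rcases ht.eq_or_lt with rfl | ht'
    · simp [powerPotential]
    · have : powerPotential 0 t = ((Real.log t : ℝ) : EReal) := by
        simp [powerPotential, ht'.ne']
      rw [this, EReal.coe_le_coe_iff]
      have e : 1 / (2 * s ^ 2) * (t ^ 2 - s ^ 2) = (t ^ 2 / s ^ 2 - 1) / 2 := by
        field_simp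
      have := hlog t ht'
      rw [e]
      linarith
  · have hv : ∀ t, powerPotential α t = ((t ^ α : ℝ) : EReal) := by
      simp [powerPotential, h0]
    rw [hv, EReal.toReal_coe]
    refine ⟨rfl, α / 2 * s ^ α / s ^ 2, by positivity, fun t ht => ?_⟩
    have hb : ((t / s) ^ 2) ^ (α / 2) ≤ 1 + α / 2 * ((t / s) ^ 2 - 1) := by
      have h := rpow_one_add_le_one_add_mul_self (s := (t / s) ^ 2 - 1) (p := α / 2)
        (by linarith [sq_nonneg (t / s)]) (by linarith) (by linarith)
      rwa [add_sub_cancel] at h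
    rw [hv, EReal.coe_le_coe_iff, key t ht]
    have e : α / 2 * s ^ α / s ^ 2 * (t ^ 2 - s ^ 2)
        = s ^ α * (α / 2 * (t ^ 2 / s ^ 2 - 1)) := by field_simp
    rw [e, ← div_pow]
    nlinarith

theorem sin_nat_mul_mul_sin_le (j : ℕ) {x y : ℝ} (hx : 0 ≤ x) (hxy : x ≤ y)
    (hy : y ≤ Real.pi / 2) (hj : j * y ≤ Real.pi) :
    Real.sin (j * y) * Real.sin x ≤ Real.sin (j * x) * Real.sin y := by
  have hpi := Real.pi_pos
  have hsx : 0 ≤ Real.sin x := Real.sin_nonneg_of_nonneg_of_le_pi hx (by linarith)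
  have hsy : 0 ≤ Real.sin y := Real.sin_nonneg_of_nonneg_of_le_pi (hx.trans hxy) (by linarith)
  have hcy : 0 ≤ Real.cos y := Real.cos_nonneg_of_mem_Icc ⟨by linarith, hy⟩
  have hc : Real.cos y ≤ Real.cos x := Real.cos_le_cos_of_nonneg_of_le_pi hx (by linarith) hxy
  induction j with
  | zero => simp
  | succ j ih =>
    push_cast at hj ⊢
    have hjy : (j : ℝ) * y ≤ Real.pi := by nlinarith
    have hj0 : (0 : ℝ) ≤ j := j.cast_nonneg
    have hjx : (j : ℝ) * x ≤ j * y := by gcongr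
    have ih := ih hjy
    have hcj : Real.cos (j * y) ≤ Real.cos (j * x) :=
      Real.cos_le_cos_of_nonneg_of_le_pi (by positivity) hjy hjx
    have hsj : 0 ≤ Real.sin (j * x) :=
      Real.sin_nonneg_of_nonneg_of_le_pi (by positivity) (by linarith)
    rw [add_one_mul, Real.sin_add, add_one_mul, Real.sin_add]
    have h1 := mul_le_mul_of_nonneg_right ih hcy
    have h2 := mul_le_mul_of_nonneg_right hc (mul_nonneg hsj hsy)
    have h3 := mul_le_mul_of_nonneg_right hcj (mul_nonneg hsx hsy)
    nlinarith

theorem abs_sin_mul_mul_sin_le {a b : ℕ} {θ : ℝ} (hθ : 0 < θ) (ha : 1 ≤ a) (hb : 1 ≤ b)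
    (haθ : a * θ ≤ Real.pi / 2) (hbθ : b * θ ≤ Real.pi / 2) :
    |Real.sin (a * b * θ)| * Real.sin θ ≤ Real.sin (a * θ) * Real.sin (b * θ) := by
  have hpi := Real.pi_pos
  have ha1 : (1 : ℝ) ≤ a := by exact_mod_cast ha
  have hb1 : (1 : ℝ) ≤ b := by exact_mod_cast hb
  have hbθ' : θ ≤ b * θ := by nlinarith
  rcases le_or_gt (a * (b * θ)) Real.pi with h | h
  · rw [mul_assoc, abs_of_nonneg (Real.sin_nonneg_of_nonneg_of_le_pi (by positivity) h)]
    exact sin_nat_mul_mul_sin_le a hθ.le hbθ' hbθ h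
  · have hsθ : 0 ≤ Real.sin θ := Real.sin_nonneg_of_nonneg_of_le_pi hθ.le (by linarith)
    have hsa : 0 ≤ Real.sin (a * θ) :=
      Real.sin_nonneg_of_nonneg_of_le_pi (by positivity) (by linarith)
    have hy : θ ≤ Real.pi / (2 * a) := by
      rw [le_div_iff₀ (by positivity)]
      nlinarith
    have hya : (a : ℝ) * (Real.pi / (2 * a)) = Real.pi / 2 := by field_simp
    have hy2 : Real.pi / (2 * a) ≤ Real.pi / 2 := by
      rw [← hya]
      exact le_mul_of_one_le_left (by positivity) ha1
    have h1 := sin_nat_mul_mul_sin_le a hθ.le hy hy2 (by rw [hya]; linarith)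
    rw [hya, Real.sin_pi_div_two, one_mul] at h1
    have hle : Real.pi / (2 * a) ≤ b * θ := by
      rw [div_le_iff₀ (by positivity)]
      nlinarith
    have h2 : Real.sin (Real.pi / (2 * a)) ≤ Real.sin (b * θ) :=
      Real.sin_le_sin_of_le_of_le_pi_div_two (by linarith) hbθ hle
    calc |Real.sin (a * b * θ)| * Real.sin θ ≤ 1 * Real.sin θ := by
          gcongr
          exact Real.abs_sin_le_one _
      _ ≤ Real.sin (a * θ) * Real.sin (Real.pi / (2 * a)) := by rwa [one_mul]
      _ ≤ _ := by gcongr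

open ZMod in
/-- The length of the chord between the `n`-th roots of unity with indices `0` and `j`. -/
noncomputable def rootChord {n : ℕ} [NeZero n] (j : ZMod n) : ℝ := ‖stdAddChar j - 1‖

section rootChord

open ZMod ComplexConjugate

variable {n : ℕ} [NeZero n]

theorem norm_stdAddChar (j : ZMod n) : ‖stdAddChar j‖ = 1 := by
  rw [stdAddChar_apply, Circle.norm_coe]

theorem conj_stdAddChar (j : ZMod n) : conj (stdAddChar j) = stdAddChar (-j) := by
  rw [AddChar.map_neg_eq_inv, Complex.inv_eq_conj (norm_stdAddChar j)]

theorem norm_stdAddChar_sub (p q : ZMod n) :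
    ‖stdAddChar q - stdAddChar p‖ = rootChord (q - p) := by
  have : stdAddChar q - stdAddChar p = stdAddChar p * (stdAddChar (q - p) - 1) := by
    rw [mul_sub, ← AddChar.map_add_eq_mul, add_sub_cancel, mul_one]
  rw [this, norm_mul, norm_stdAddChar, one_mul, rootChord]

theorem rootChord_nonneg (j : ZMod n) : 0 ≤ rootChord j := norm_nonneg _

theorem rootChord_zero : rootChord (0 : ZMod n) = 0 := by simp [rootChord]

theorem rootChord_neg (j : ZMod n) : rootChord (-j) = rootChord j := by
  rw [rootChord, rootChord, ← conj_stdAddChar, ← Complex.norm_conj]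
  simp

theorem rootChord_pos {j : ZMod n} (hj : j ≠ 0) : 0 < rootChord j := by
  refine norm_pos_iff.2 (sub_ne_zero.2 fun h => hj ?_)
  exact injective_stdAddChar (h.trans (AddChar.map_zero_eq_one _).symm)

theorem rootChord_natCast (a : ℕ) :
    rootChord (a : ZMod n) = 2 * |Real.sin (a * (Real.pi / n))| := by
  have h := stdAddChar_coe (N := n) (a : ℤ)
  have e : (2 * Real.pi * Complex.I * ((a : ℤ) : ℂ) / n : ℂ)
      = Complex.I * ((2 * (a * (Real.pi / n)) : ℝ) : ℂ) := by
    push_cast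
    ring
  rw [e] at h
  push_cast at h
  rw [rootChord, h]
  have := Complex.norm_exp_I_mul_ofReal_sub_one (2 * (a * (Real.pi / n)))
  push_cast at this
  rw [this, mul_div_cancel_left₀ _ two_ne_zero, norm_mul, Real.norm_two, Real.norm_eq_abs]

theorem rootChord_mul_le (j k : ZMod n) :
    rootChord (j * k) * rootChord (1 : ZMod n) ≤ rootChord j * rootChord k := by
  have red : ∀ j : ZMod n, ∃ a : ℕ, a ≤ n / 2 ∧ (j = (a : ZMod n) ∨ j = -(a : ZMod n)) := by
    intro j
    refine ⟨j.valMinAbs.natAbs, ZMod.natAbs_valMinAbs_le j, ?_⟩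
    refine (Int.natAbs_eq j.valMinAbs).imp (fun h => ?_) (fun h => ?_) <;>
    · have h' := congrArg (Int.cast : ℤ → ZMod n) h
      rw [ZMod.coe_valMinAbs] at h'
      simpa only [Int.cast_neg, Int.cast_natCast] using h'
  have main : ∀ a b : ℕ, a ≤ n / 2 → b ≤ n / 2 →
      rootChord ((a : ZMod n) * (b : ZMod n)) * rootChord (1 : ZMod n)
        ≤ rootChord (a : ZMod n) * rootChord (b : ZMod n) := by
    intro a b ha hb
    rcases Nat.eq_zero_or_pos a with rfl | ha0
    · simp [rootChord_zero]
    rcases Nat.eq_zero_or_pos b with rfl | hb0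
    · simp [rootChord_zero]
    have hn : (0 : ℝ) < n := by exact_mod_cast Nat.pos_of_neZero n
    have bound : ∀ c : ℕ, c ≤ n / 2 → c * (Real.pi / n) ≤ Real.pi / 2 := by
      intro c hc
      have h2 : 2 * c ≤ n := by omega
      have h2' : (2 * c : ℝ) ≤ n := by exact_mod_cast h2
      rw [← mul_div_assoc, div_le_div_iff₀ hn two_pos]
      nlinarith [Real.pi_pos]
    have hpos : ∀ c : ℕ, c ≤ n / 2 → 0 ≤ Real.sin (c * (Real.pi / n)) := fun c hc =>
      Real.sin_nonneg_of_nonneg_of_le_pi (by positivity)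
        (by linarith [bound c hc, Real.pi_pos])
    have h := abs_sin_mul_mul_sin_le (a := a) (b := b) (θ := Real.pi / n) (by positivity)
      ha0 hb0 (bound a ha) (bound b hb)
    have h1 : rootChord (1 : ZMod n) = 2 * Real.sin (Real.pi / n) := by
      have := rootChord_natCast (n := n) 1
      rw [abs_of_nonneg (hpos 1 (by omega))] at this
      simpa using this
    have hab := rootChord_natCast (n := n) (a * b)
    push_cast at hab
    rw [h1, hab, rootChord_natCast, rootChord_natCast, abs_of_nonneg (hpos a ha),
      abs_of_nonneg (hpos b hb)]
    linarith
  obtain ⟨a, ha, hja⟩ := red j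
  obtain ⟨b, hb, hkb⟩ := red k
  have := main a b ha hb
  rcases hja with rfl | rfl <;> rcases hkb with rfl | rfl <;>
    simpa only [neg_mul, mul_neg, neg_neg, rootChord_neg] using this

theorem rootChord_two_mul (j : ZMod n) :
    rootChord (2 * j) = rootChord j * ‖stdAddChar j + 1‖ := by
  rw [rootChord, rootChord, ← norm_mul, two_mul, AddChar.map_add_eq_mul]
  congr 1
  ring

theorem eq_one_or_eq_neg_one_of_rootChord_two_mul {j : ZMod n} (hj : j ≠ 0)
    (h1 : (1 : ZMod n) ≠ 0)
    (h : rootChord (j * 2) * rootChord (1 : ZMod n) = rootChord j * rootChord (2 : ZMod n)) :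
    j = 1 ∨ j = -1 := by
  have h2 := rootChord_two_mul (1 : ZMod n)
  rw [mul_one] at h2
  rw [h2, mul_comm j, rootChord_two_mul] at h
  have hn : ‖stdAddChar j + 1‖ = ‖stdAddChar (1 : ZMod n) + 1‖ := by
    have hp := mul_pos (rootChord_pos hj) (rootChord_pos h1)
    refine mul_left_cancel₀ hp.ne' ?_
    linarith
  have hsq : ∀ i : ZMod n, ‖stdAddChar i + 1‖ ^ 2 = 2 + 2 * (stdAddChar i).re := by
    intro i
    have := norm_stdAddChar i
    rw [← sq_eq_sq₀ (norm_nonneg _) zero_le_one, Complex.sq_norm, Complex.normSq_apply] at this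
    rw [Complex.sq_norm, Complex.normSq_apply]
    simp only [Complex.add_re, Complex.add_im, Complex.one_re, Complex.one_im]
    linarith
  have hre : (stdAddChar j).re = (stdAddChar (1 : ZMod n)).re := by
    have a := hsq j
    rw [hn, hsq 1] at a
    linarith
  have him : (stdAddChar j).im ^ 2 = (stdAddChar (1 : ZMod n)).im ^ 2 := by
    have unit : ∀ i : ZMod n, (stdAddChar i).re ^ 2 + (stdAddChar i).im ^ 2 = 1 := by
      intro i
      have := norm_stdAddChar i
      rw [← sq_eq_sq₀ (norm_nonneg _) zero_le_one, Complex.sq_norm, Complex.normSq_apply] at this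
      linarith
    have a := unit j
    have b := unit 1
    rw [hre] at a
    linarith
  rcases sq_eq_sq_iff_eq_or_eq_neg.1 him with h' | h'
  · exact Or.inl (injective_stdAddChar (Complex.ext hre h'))
  · refine Or.inr (injective_stdAddChar ?_)
    rw [← conj_stdAddChar]
    exact Complex.ext hre h'

theorem sum_norm_sq_dft (z : ZMod n → ℂ) :
    ∑ j, ‖dft z j‖ ^ 2 = n * ∑ p, ‖z p‖ ^ 2 := by
  have h : ∑ j, dft z j * conj (dft z j) = n * ∑ p, z p * conj (z p) := by
    have e : ∀ j, dft z j * conj (dft z j)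
        = ∑ p, conj (z p) * (stdAddChar (-(j * -p)) * dft z j) := by
      intro j
      conv_lhs => rw [dft_apply z j, map_sum, ← dft_apply z j, Finset.mul_sum]
      refine Finset.sum_congr rfl fun p _ => ?_
      rw [smul_eq_mul, map_mul, conj_stdAddChar, neg_neg, mul_neg, neg_neg, mul_comm p j]
      ring
    simp_rw [e]
    rw [Finset.sum_comm, Finset.mul_sum]
    refine Finset.sum_congr rfl fun p _ => ?_
    rw [← Finset.mul_sum]
    have := congrFun (dft_dft z) (-p)
    rw [dft_apply] at this
    simp only [smul_eq_mul, neg_neg] at this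
    simp only [this]
    ring
  simp_rw [Complex.mul_conj, Complex.normSq_eq_norm_sq] at h
  exact_mod_cast h

theorem dft_shift_sub (z : ZMod n → ℂ) (k j : ZMod n) :
    dft (fun p => z (p + k) - z p) j = (stdAddChar (j * k) - 1) * dft z j := by
  simp only [dft_apply, smul_eq_mul, mul_sub, Finset.sum_sub_distrib, sub_mul, one_mul]
  congr 1
  rw [Finset.mul_sum, ← Equiv.sum_comp (Equiv.addRight k)
    (fun p => stdAddChar (j * k) * (stdAddChar (-(p * j)) * z p))]
  refine Finset.sum_congr rfl fun p _ => ?_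
  rw [Equiv.coe_addRight, ← mul_assoc, ← AddChar.map_add_eq_mul]
  congr 2
  ring

theorem sum_norm_sq_shift_sub (z : ZMod n → ℂ) (k : ZMod n) :
    n * ∑ p, ‖z (p + k) - z p‖ ^ 2 = ∑ j, rootChord (j * k) ^ 2 * ‖dft z j‖ ^ 2 := by
  rw [← sum_norm_sq_dft]
  refine Finset.sum_congr rfl fun j _ => ?_
  rw [dft_shift_sub, norm_mul, mul_pow, rootChord]

/-- Among closed polygons with given sum of squared edges, the sum of the squared `k`-diagonals
is largest for the regular polygon. -/
theorem sum_norm_sq_diagonal_le (z : ZMod n → ℂ) (k : ZMod n) :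
    rootChord (1 : ZMod n) ^ 2 * ∑ p, ‖z (p + k) - z p‖ ^ 2
      ≤ rootChord k ^ 2 * ∑ p, ‖z (p + 1) - z p‖ ^ 2 := by
  have hn : (0 : ℝ) < n := by exact_mod_cast Nat.pos_of_neZero n
  refine le_of_mul_le_mul_left ?_ hn
  rw [mul_left_comm, sum_norm_sq_shift_sub, mul_left_comm (n : ℝ), sum_norm_sq_shift_sub,
    Finset.mul_sum, Finset.mul_sum]
  refine Finset.sum_le_sum fun j _ => ?_
  have h := mul_le_mul_of_nonneg_right (pow_le_pow_left₀
    (mul_nonneg (rootChord_nonneg _) (rootChord_nonneg _)) (rootChord_mul_le j k) 2)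
    (sq_nonneg ‖dft z j‖)
  rw [mul_one]
  linarith

theorem dft_eq_zero_of_sum_norm_sq_diagonal_eq {z : ZMod n → ℂ} (h1 : (1 : ZMod n) ≠ 0)
    (h : rootChord (1 : ZMod n) ^ 2 * ∑ p, ‖z (p + 2) - z p‖ ^ 2
      = rootChord (2 : ZMod n) ^ 2 * ∑ p, ‖z (p + 1) - z p‖ ^ 2)
    {j : ZMod n} (hj : j ≠ 0) (hj1 : j ≠ 1) (hj2 : j ≠ -1) : dft z j = 0 := by
  have h' : (n : ℝ) * (rootChord (1 : ZMod n) ^ 2 * ∑ p, ‖z (p + 2) - z p‖ ^ 2)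
      = n * (rootChord (2 : ZMod n) ^ 2 * ∑ p, ‖z (p + 1) - z p‖ ^ 2) := by rw [h]
  rw [mul_left_comm, sum_norm_sq_shift_sub, mul_left_comm (n : ℝ), sum_norm_sq_shift_sub,
    Finset.mul_sum, Finset.mul_sum] at h'
  have hle : ∀ i : ZMod n, rootChord (i * 2) * rootChord (1 : ZMod n)
      ≤ rootChord i * rootChord (2 : ZMod n) := fun i => rootChord_mul_le i 2
  have hterm := (Finset.sum_eq_sum_iff_of_le (fun i _ => ?_)).1 h' j (Finset.mem_univ j)
  · rw [mul_one] at hterm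
    by_contra hne
    have hd : (0 : ℝ) < ‖dft z j‖ ^ 2 := by positivity
    have hsq : (rootChord (j * 2) * rootChord (1 : ZMod n)) ^ 2
        = (rootChord j * rootChord (2 : ZMod n)) ^ 2 := by
      refine mul_right_cancel₀ hd.ne' ?_
      linarith
    rw [sq_eq_sq₀ (mul_nonneg (rootChord_nonneg _) (rootChord_nonneg _))
      (mul_nonneg (rootChord_nonneg _) (rootChord_nonneg _))] at hsq
    rcases eq_one_or_eq_neg_one_of_rootChord_two_mul hj h1 hsq with h | h
    · exact hj1 h
    · exact hj2 h
  · have h0 := pow_le_pow_left₀ (mul_nonneg (rootChord_nonneg _) (rootChord_nonneg _)) (hle i) 2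
    have := mul_le_mul_of_nonneg_right h0 (sq_nonneg ‖dft z i‖)
    rw [mul_one]
    linarith

/-- An equilateral polygon with unit edges whose only frequencies are `0`, `1` and `-1` is a
regular polygon. -/
theorem exists_eq_of_dft_eq_zero {z : ZMod n → ℂ} (hn : 5 ≤ n)
    (hz : ∀ p, ‖z (p + 1) - z p‖ = 1)
    (h : ∀ j : ZMod n, j ≠ 0 → j ≠ 1 → j ≠ -1 → dft z j = 0) :
    ∃ c a : ℂ, ‖a‖ * rootChord (1 : ZMod n) = 1 ∧
      ((∀ p, z p = c + a * stdAddChar p) ∨ ∀ p, z p = c + a * conj (stdAddChar p)) := by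
  have hnat : ∀ m : ℕ, 0 < m → m < n → (m : ZMod n) ≠ 0 := by
    intro m hm hmn h0
    exact absurd (Nat.le_of_dvd hm ((ZMod.natCast_eq_zero_iff m n).1 h0)) (by omega)
  have h1 : (1 : ZMod n) ≠ 0 := by simpa using hnat 1 one_pos (by omega)
  have h2 : (2 : ZMod n) ≠ 0 := by simpa using hnat 2 two_pos (by omega)
  have h4 : (4 : ZMod n) ≠ 0 := by simpa using hnat 4 (by norm_num) (by omega)
  have h11 : (1 : ZMod n) ≠ -1 := fun h => h2 (by linear_combination h)
  have hform : ∃ c a b : ℂ, ∀ p, z p = c + a * stdAddChar p + b * conj (stdAddChar p) := by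
    refine ⟨(n : ℂ)⁻¹ * dft z 0, (n : ℂ)⁻¹ * dft z 1, (n : ℂ)⁻¹ * dft z (-1), fun p => ?_⟩
    have e := congrFun (dft.symm_apply_apply z) p
    rw [invDFT_apply] at e
    rw [← e, ← Finset.sum_subset (Finset.subset_univ {0, 1, -1}), Finset.sum_insert,
      Finset.sum_insert, Finset.sum_singleton, conj_stdAddChar]
    · simp only [smul_eq_mul, zero_mul, AddChar.map_zero_eq_one, one_mul, neg_mul]
      ring
    · simpa using h11
    · simpa using ⟨h1.symm, h1⟩
    · intro j _ hj
      simp only [Finset.mem_insert, Finset.mem_singleton, not_or] at hj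
      rw [h j hj.1 hj.2.1 hj.2.2, smul_zero]
  obtain ⟨c, a, b, hz'⟩ := hform
  set ω : ℂ := stdAddChar (1 : ZMod n) with hω
  have hωn : ω * conj ω = 1 := by
    rw [Complex.mul_conj, Complex.normSq_eq_norm_sq, norm_stdAddChar]
    norm_num
  have hω1 : ω - 1 ≠ 0 := norm_pos_iff.1 (rootChord_pos h1)
  have hω1' : conj ω - 1 ≠ 0 := by
    intro h0
    apply hω1
    have := congrArg conj h0
    simpa using this
  have hω4 : ω ^ 4 ≠ 1 := by
    intro h0
    apply h4
    apply injective_stdAddChar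
    rw [AddChar.map_zero_eq_one, ← h0, hω, ← AddChar.map_nsmul_eq_pow]
    simp
  set u := a * (ω - 1) with hu
  set v := b * (conj ω - 1) with hv
  have hedge : ∀ p, z (p + 1) - z p = u * stdAddChar p + v * conj (stdAddChar p) := by
    intro p
    rw [hz', hz', AddChar.map_add_eq_mul, map_mul]
    ring
  have hedge2 : ∀ p : ZMod n, ‖u‖ ^ 2 + ‖v‖ ^ 2 + 2 * (u * conj v * stdAddChar p ^ 2).re = 1 := by
    intro p
    have e : ‖u * stdAddChar p + v * conj (stdAddChar p)‖ ^ 2 = 1 := by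
      rw [← hedge, hz, one_pow]
    have e1 : u * stdAddChar p * conj (v * conj (stdAddChar p))
        = u * conj v * stdAddChar p ^ 2 := by
      rw [map_mul, Complex.conj_conj]
      ring
    rw [Complex.sq_norm, Complex.normSq_add, e1, Complex.normSq_eq_norm_sq,
      Complex.normSq_eq_norm_sq, norm_mul u, norm_mul v, Complex.norm_conj, norm_stdAddChar,
      mul_one, mul_one] at e
    exact e
  set w := u * conj v with hw
  have hw0 : w = 0 := by
    have e0 := hedge2 0
    have e1 := hedge2 1
    have e2 := hedge2 (-1)
    rw [AddChar.map_zero_eq_one, one_pow, mul_one] at e0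
    rw [← hω] at e1
    rw [← conj_stdAddChar, ← hω] at e2
    set ζ := ω ^ 2 with hζ
    have hζc : conj ω ^ 2 = conj ζ := by rw [hζ, map_pow]
    rw [hζc] at e2
    have hζn : ζ.re ^ 2 + ζ.im ^ 2 = 1 := by
      have : ζ * conj ζ = 1 := by
        rw [← hζc, hζ, ← mul_pow, hωn, one_pow]
      rw [Complex.mul_conj, Complex.normSq_apply] at this
      have : ζ.re * ζ.re + ζ.im * ζ.im = 1 := by exact_mod_cast this
      linarith
    have hζi : ζ.im ≠ 0 := by
      intro h0
      rw [h0] at hζn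
      apply hω4
      have : ζ ^ 2 = 1 := by
        have hr : ζ = (ζ.re : ℂ) := Complex.ext rfl (by simpa using h0)
        rw [hr]
        have : ζ.re ^ 2 = 1 := by linarith
        exact_mod_cast this
      rw [← this, hζ]
      ring
    have hζr : ζ.re ≠ 1 := by
      intro h0
      rw [h0] at hζn
      exact hζi (pow_eq_zero_iff two_ne_zero |>.1 (by linarith))
    simp only [Complex.mul_re, Complex.conj_re, Complex.conj_im] at e1 e2
    have hi : w.im = 0 := by
      have : w.im * ζ.im = 0 := by linarith
      exact (mul_eq_zero.1 this).resolve_right hζi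
    have hr : w.re = 0 := by
      have : w.re * (ζ.re - 1) = 0 := by linarith
      exact (mul_eq_zero.1 this).resolve_right (sub_ne_zero.2 hζr)
    exact Complex.ext hr hi
  have hnorm : ‖conj ω - 1‖ = ‖ω - 1‖ := by
    rw [← Complex.norm_conj]
    simp
  have e0 := hedge2 0
  rw [hw0, zero_mul, Complex.zero_re, mul_zero, add_zero] at e0
  rcases mul_eq_zero.1 hw0 with h0 | h0
  · have ha : a = 0 := (mul_eq_zero.1 h0).resolve_right hω1
    refine ⟨c, b, ?_, Or.inr fun p => by rw [hz', ha, zero_mul, add_zero]⟩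
    rw [h0, norm_zero, zero_pow two_ne_zero, zero_add] at e0
    rw [rootChord, ← hω, ← hnorm, ← norm_mul, ← hv]
    exact (pow_eq_one_iff_of_nonneg (norm_nonneg _) two_ne_zero).1 e0
  · have hv0 : v = 0 := by simpa using h0
    have hb : b = 0 := (mul_eq_zero.1 hv0).resolve_right hω1'
    refine ⟨c, a, ?_, Or.inl fun p => by rw [hz', hb, zero_mul, add_zero]⟩
    rw [hv0, norm_zero, zero_pow two_ne_zero, add_zero] at e0
    rw [rootChord, ← hω, ← norm_mul, ← hu]
    exact (pow_eq_one_iff_of_nonneg (norm_nonneg _) two_ne_zero).1 e0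

end rootChord

theorem orientedArea_eq_zero_of_collinear {s : Set Plane} (hs : Collinear ℝ s) {P Q R : Plane}
    (hP : P ∈ s) (hQ : Q ∈ s) (hR : R ∈ s) : orientedArea P Q R = 0 := by
  obtain ⟨v, hv⟩ := (collinear_iff_of_mem hP).1 hs
  obtain ⟨a, rfl⟩ := hv Q hQ
  obtain ⟨b, rfl⟩ := hv R hR
  simp only [orientedArea, vadd_eq_add, PiLp.add_apply, PiLp.smul_apply, smul_eq_mul]
  ring

theorem exists_orientedArea_map_eq (τ : Plane ≃ᵢ Plane) :
    ∃ d : ℝ, ∀ P Q R, orientedArea (τ P) (τ Q) (τ R) = d * orientedArea P Q R := by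
  set f := τ.toRealAffineIsometryEquiv with hf
  set L := f.linearIsometryEquiv with hL
  set e : Fin 2 → Plane := fun i => EuclideanSpace.single i 1 with he
  refine ⟨L (e 0) 0 * L (e 1) 1 - L (e 0) 1 * L (e 1) 0, fun P Q R => ?_⟩
  have hexp : ∀ v : Plane, v = v 0 • e 0 + v 1 • e 1 := by
    intro v
    ext i
    fin_cases i <;> simp [he]
  have hdiff : ∀ X Y : Plane, ∀ i, τ Y i - τ X i
      = (Y 0 - X 0) * L (e 0) i + (Y 1 - X 1) * L (e 1) i := by
    intro X Y i
    have h := f.map_vsub Y X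
    rw [← hL, vsub_eq_sub, hexp (Y - X), map_add, map_smul, map_smul] at h
    have h' := congrArg (fun w : Plane => w i) h
    simpa [hf] using h'.symm
  simp only [orientedArea, hdiff]
  ring

theorem orientedArea_regularPolygon {n : ℕ} (i j k : Fin n) :
    orientedArea (regularPolygon n i) (regularPolygon n j) (regularPolygon n k)
      = (1 / (2 * Real.sin (Real.pi / n))) ^ 2 *
        (4 * Real.sin (((j : ℕ) - (i : ℕ)) * (Real.pi / n))
          * Real.sin (((k : ℕ) - (i : ℕ)) * (Real.pi / n))
          * Real.sin (((k : ℕ) - (j : ℕ)) * (Real.pi / n))) := by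
  set r := 1 / (2 * Real.sin (Real.pi / n))
  have hx : ∀ m : Fin n, regularPolygon n m 0
      = r * (Real.cos ((m : ℕ) * (Real.pi / n)) ^ 2
          - Real.sin ((m : ℕ) * (Real.pi / n)) ^ 2) := by
    intro m
    rw [← Real.cos_two_mul']
    simp only [regularPolygon, PiLp.smul_apply, smul_eq_mul, Matrix.cons_val_zero]
    congr 2
    ring
  have hy : ∀ m : Fin n, regularPolygon n m 1
      = r * (2 * Real.sin ((m : ℕ) * (Real.pi / n)) * Real.cos ((m : ℕ) * (Real.pi / n))) := by
    intro m
    rw [← Real.sin_two_mul]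
    simp only [regularPolygon, PiLp.smul_apply, smul_eq_mul, Matrix.cons_val_one,
      Matrix.cons_val_fin_one]
    congr 2
    ring
  simp only [orientedArea, hx, hy, sub_mul, Real.sin_sub]
  have ci := Real.sin_sq_add_cos_sq ((i : ℕ) * (Real.pi / n))
  have cj := Real.sin_sq_add_cos_sq ((j : ℕ) * (Real.pi / n))
  have ck := Real.sin_sq_add_cos_sq ((k : ℕ) * (Real.pi / n))
  generalize Real.sin ((i : ℕ) * (Real.pi / n)) = a at *
  generalize Real.cos ((i : ℕ) * (Real.pi / n)) = a' at *
  generalize Real.sin ((j : ℕ) * (Real.pi / n)) = b at *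
  generalize Real.cos ((j : ℕ) * (Real.pi / n)) = b' at *
  generalize Real.sin ((k : ℕ) * (Real.pi / n)) = c at *
  generalize Real.cos ((k : ℕ) * (Real.pi / n)) = c' at *
  linear_combination
    -r ^ 2 * (2 * c * c' * (b' ^ 2 - b ^ 2) - (c' ^ 2 - c ^ 2) * (2 * b * b')) * ci
    - r ^ 2 * (2 * a * a' * (c' ^ 2 - c ^ 2) - (a' ^ 2 - a ^ 2) * (2 * c * c')) * cj
    - r ^ 2 * (2 * b * b' * (a' ^ 2 - a ^ 2) - (b' ^ 2 - b ^ 2) * (2 * a * a')) * ck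

theorem sin_sub_mul_pi_div_pos {n i j : ℕ} (hij : i < j) (hj : j < n) :
    0 < Real.sin (((j : ℝ) - i) * (Real.pi / n)) := by
  have hn : (0 : ℝ) < n := by exact_mod_cast (Nat.zero_le j).trans_lt hj
  have h1 : (0 : ℝ) < (j : ℝ) - i := sub_pos.2 (by exact_mod_cast hij)
  refine Real.sin_pos_of_pos_of_lt_pi (by positivity) ?_
  have h2 : (j : ℝ) - i < n := by
    have : (j : ℝ) < n := by exact_mod_cast hj
    have : (0 : ℝ) ≤ i := i.cast_nonneg
    linarith
  rw [← mul_div_assoc, div_lt_iff₀ hn]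
  nlinarith [Real.pi_pos]

theorem orientedArea_regularPolygon_pos {n : ℕ} {i j k : Fin n} (hij : i < j) (hjk : j < k) :
    0 < orientedArea (regularPolygon n i) (regularPolygon n j) (regularPolygon n k) := by
  have h1 := sin_sub_mul_pi_div_pos hij j.isLt
  have h2 := sin_sub_mul_pi_div_pos (hij.trans hjk) k.isLt
  have h3 := sin_sub_mul_pi_div_pos hjk k.isLt
  have h4 : 0 < Real.sin (Real.pi / n) := by
    have : i.val + 1 < n := by have := j.isLt; omega
    simpa using sin_sub_mul_pi_div_pos (i := 0) (j := 1) one_pos (by omega : 1 < n)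
  rw [orientedArea_regularPolygon]
  positivity

theorem isNondegenerateConvexPolygon_of_isUnitRegularPolygon {n : ℕ} (hn : 3 ≤ n)
    {A : Fin n → Plane} (hA : IsUnitRegularPolygon A) : IsNondegenerateConvexPolygon A := by
  obtain ⟨τ, hτ⟩ := hA
  constructor
  · intro hcol
    obtain ⟨d, hd⟩ := exists_orientedArea_map_eq τ.symm
    have hpos := orientedArea_regularPolygon_pos (n := n) (i := ⟨0, by omega⟩)
      (j := ⟨1, by omega⟩) (k := ⟨2, by omega⟩) (by simp) (by simp)
    have h := hd (A ⟨0, by omega⟩) (A ⟨1, by omega⟩) (A ⟨2, by omega⟩)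
    rw [orientedArea_eq_zero_of_collinear hcol (Set.mem_range_self _) (Set.mem_range_self _)
      (Set.mem_range_self _), mul_zero, hτ, hτ, hτ, τ.symm_apply_apply, τ.symm_apply_apply,
      τ.symm_apply_apply] at h
    exact hpos.ne' h
  · obtain ⟨d, hd⟩ := exists_orientedArea_map_eq τ
    refine (le_total 0 d).imp (fun h i j k hij hjk => ?_) (fun h i j k hij hjk => ?_) <;>
      rw [hτ, hτ, hτ, hd]
    · exact mul_nonneg h (orientedArea_regularPolygon_pos hij hjk).le
    · exact mul_nonpos_of_nonpos_of_nonneg h (orientedArea_regularPolygon_pos hij hjk).le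

section rootOfUnity

open ZMod ComplexConjugate

variable {n : ℕ} [NeZero n]

theorem finEquiv_eq_natCast (k : Fin n) : ZMod.finEquiv n k = ((k : ℕ) : ZMod n) := by
  obtain ⟨m, rfl⟩ := Nat.exists_eq_succ_of_ne_zero (NeZero.ne n)
  exact (ZMod.natCast_zmod_val (n := m + 1) k).symm

/-- The linear isometry identifying `ℂ` with the plane. -/
noncomputable def complexToPlane : ℂ ≃ₗᵢ[ℝ] Plane := Complex.orthonormalBasisOneI.repr

theorem rootChord_one : rootChord (1 : ZMod n) = 2 * Real.sin (Real.pi / n) := by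
  have h := rootChord_natCast (n := n) 1
  have hn : (1 : ℝ) ≤ n := by exact_mod_cast Nat.pos_of_neZero n
  rw [Nat.cast_one, Nat.cast_one, one_mul, abs_of_nonneg] at h
  · exact h
  · exact Real.sin_nonneg_of_nonneg_of_le_pi (by positivity) (div_le_self Real.pi_pos.le hn)

theorem regularPolygon_eq_complexToPlane (k : Fin n) :
    regularPolygon n k
      = complexToPlane (((rootChord (1 : ZMod n))⁻¹ : ℝ) * stdAddChar (ZMod.finEquiv n k)) := by
  have h := stdAddChar_coe (N := n) ((k : ℕ) : ℤ)
  have e : (2 * Real.pi * Complex.I * (((k : ℕ) : ℤ) : ℂ) / n : ℂ)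
      = ((2 * Real.pi * (k : ℕ) / n : ℝ) : ℂ) * Complex.I := by
    push_cast
    ring
  rw [e, Int.cast_natCast] at h
  rw [finEquiv_eq_natCast, h, regularPolygon, rootChord_one, one_div]
  ext i
  fin_cases i
  · simp [complexToPlane, -Complex.ofReal_inv, -Complex.ofReal_mul, -Complex.ofReal_div,
      Complex.exp_ofReal_mul_I_re]
  · simp [complexToPlane, -Complex.ofReal_inv, -Complex.ofReal_mul, -Complex.ofReal_div,
      Complex.exp_ofReal_mul_I_im]

theorem dist_complexToPlane (x y : ℂ) :
    dist (complexToPlane x) (complexToPlane y) = ‖y - x‖ := by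
  rw [LinearIsometryEquiv.dist_map, dist_comm, dist_eq_norm]

theorem dist_regularPolygon (p q : Fin n) :
    dist (regularPolygon n p) (regularPolygon n q)
      = rootChord (ZMod.finEquiv n q - ZMod.finEquiv n p) / rootChord (1 : ZMod n) := by
  rw [regularPolygon_eq_complexToPlane, regularPolygon_eq_complexToPlane, dist_complexToPlane,
    ← mul_sub, norm_mul, norm_stdAddChar_sub, Complex.norm_real, Real.norm_eq_abs,
    abs_of_nonneg (inv_nonneg.2 (rootChord_nonneg _)), div_eq_inv_mul]

theorem finEquiv_finRotate (i : Fin n) :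
    ZMod.finEquiv n (finRotate n i) = ZMod.finEquiv n i + 1 := by
  rw [finRotate_apply, map_add, map_one]

theorem isUnitRegularPolygon_of_eq {A : Fin n → Plane} {c a : ℂ}
    (ha : ‖a‖ * rootChord (1 : ZMod n) = 1) {R : ℂ ≃ₗᵢ[ℝ] ℂ}
    (hR : ∀ (t : ℝ) (x : ℂ), R (t * x) = t * R x)
    (hA : ∀ k, A k = complexToPlane (c + a * R (stdAddChar (ZMod.finEquiv n k)))) :
    IsUnitRegularPolygon A := by
  have hr : rootChord (1 : ZMod n) ≠ 0 := by
    intro h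
    simp [h] at ha
  have hu : a * (rootChord (1 : ZMod n) : ℂ) ∈ Submonoid.unitSphere ℂ := by
    rw [← SetLike.mem_coe, Submonoid.coe_unitSphere, mem_sphere_zero_iff_norm, norm_mul, Complex.norm_real, Real.norm_eq_abs,
      abs_of_nonneg (rootChord_nonneg _), ha]
  refine ⟨complexToPlane.symm.toIsometryEquiv.trans (R.toIsometryEquiv.trans
    ((rotation ⟨_, hu⟩).toIsometryEquiv.trans ((IsometryEquiv.addLeft c).trans
      complexToPlane.toIsometryEquiv))), fun k => ?_⟩
  rw [hA, regularPolygon_eq_complexToPlane]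
  simp only [IsometryEquiv.trans_apply, LinearIsometryEquiv.coe_toIsometryEquiv,
    LinearIsometryEquiv.symm_apply_apply, hR, IsometryEquiv.addLeft_apply]
  congr 2
  refine Eq.trans ?_ (rotation_apply _ _).symm
  have hr' : (rootChord (1 : ZMod n) : ℂ) ≠ 0 := by exact_mod_cast hr
  push_cast
  field_simp

end rootOfUnity

theorem mem_unitConvexPolygons_of_isUnitRegularPolygon {n : ℕ} (hn : 3 ≤ n)
    {A : Fin n → Plane} (hA : IsUnitRegularPolygon A) : A ∈ unitConvexPolygons n := by
  refine ⟨fun i => ?_, Or.inl (isNondegenerateConvexPolygon_of_isUnitRegularPolygon hn hA)⟩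
  obtain ⟨τ, hτ⟩ := hA
  have : NeZero n := ⟨by omega⟩
  have : Fact (1 < n) := ⟨by omega⟩
  rw [hτ, hτ, τ.dist_eq, dist_regularPolygon, finEquiv_finRotate, add_sub_cancel_left,
    div_self (rootChord_pos one_ne_zero).ne']

theorem powerEnergy_eq_of_isUnitRegularPolygon {n : ℕ} (α : ℝ) {A : Fin n → Plane}
    (hA : IsUnitRegularPolygon A) : powerEnergy α A = powerEnergy α (regularPolygon n) := by
  obtain ⟨τ, hτ⟩ := hA
  simp only [powerEnergy, hτ, τ.dist_eq]

theorem two_mul_sum_sum_Ioi {n : ℕ} (f : Fin n → Fin n → ℝ) (hsymm : ∀ i j, f i j = f j i)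
    (hdiag : ∀ i, f i i = 0) : 2 * ∑ i, ∑ j ∈ Finset.Ioi i, f i j = ∑ i, ∑ j, f i j := by
  have h := Finset.sum_sum_Ioi_add_eq_sum_sum_off_diag f
  have e : ∀ i, ∑ j ∈ {i}ᶜ, f j i = ∑ j, f i j := by
    intro i
    rw [Fintype.sum_eq_add_sum_compl i, hdiag, zero_add]
    exact Finset.sum_congr rfl fun j _ => hsymm j i
  simp_rw [e] at h
  rw [← h, Finset.mul_sum]
  refine Finset.sum_congr rfl fun i _ => ?_
  rw [Finset.mul_sum]
  refine Finset.sum_congr rfl fun j _ => ?_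
  rw [hsymm j i]
  ring

theorem EReal.coe_sum_sum_Ioi {n : ℕ} (f : Fin n → Fin n → ℝ) :
    ((∑ i, ∑ j ∈ Finset.Ioi i, f i j : ℝ) : EReal)
      = ∑ i, ∑ j ∈ Finset.Ioi i, (f i j : EReal) := by
  let φ : ℝ →+ EReal := ⟨⟨Real.toEReal, EReal.coe_zero⟩, EReal.coe_add⟩
  change φ _ = ∑ i, ∑ j ∈ Finset.Ioi i, φ (f i j)
  simp only [map_sum]

open ZMod ComplexConjugate in
/-- The regular polygon maximizes the power energy among all equilateral polygons, and an
equilateral polygon with at least the same energy is regular. -/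
theorem powerEnergy_le_regularPolygon {n : ℕ} (hn : 5 ≤ n) {α : ℝ} (hα : α ≤ 2)
    {A : Fin n → Plane} (hA : ∀ i, dist (A i) (A (finRotate n i)) = 1) :
    powerEnergy α A ≤ powerEnergy α (regularPolygon n) ∧
      (powerEnergy α (regularPolygon n) ≤ powerEnergy α A → IsUnitRegularPolygon A) := by
  have : NeZero n := ⟨by omega⟩
  have : Fact (1 < n) := ⟨by omega⟩
  have h1 : (1 : ZMod n) ≠ 0 := one_ne_zero
  have h2 : (2 : ZMod n) ≠ 0 := by
    intro h
    have := (ZMod.natCast_eq_zero_iff 2 n).1 (by exact_mod_cast h)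
    exact absurd (Nat.le_of_dvd two_pos this) (by omega)
  have hr := rootChord_pos h1
  set ι := ZMod.finEquiv n with hι
  set z : ZMod n → ℂ := fun p => complexToPlane.symm (A (ι.symm p)) with hz
  have hAz : ∀ k, A k = complexToPlane (z (ι k)) := by simp [hz]
  have hdist : ∀ p q, dist (A p) (A q) = ‖z (ι q) - z (ι p)‖ := by
    intro p q
    rw [hAz, hAz, dist_complexToPlane]
  have hedge : ∀ p, ‖z (p + 1) - z p‖ = 1 := by
    intro p
    have h := hA (ι.symm p)
    rwa [hdist, finEquiv_finRotate, ← hι, ι.apply_symm_apply] at h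
  have hS1 : ∑ p, ‖z (p + 1) - z p‖ ^ 2 = n := by simp [hedge]
  set R : ZMod n → ℝ := fun k => rootChord k / rootChord (1 : ZMod n) with hR
  have hRpos : ∀ k, k ≠ 0 → 0 < R k := fun k hk => div_pos (rootChord_pos hk) hr
  have hRneg : ∀ k, R (-k) = R k := fun k => by simp only [hR, rootChord_neg]
  have hR0 : R 0 = 0 := by simp [hR, rootChord_zero]
  have hSk : ∀ k, ∑ p, ‖z (p + k) - z p‖ ^ 2 ≤ n * R k ^ 2 := by
    intro k
    have h := sum_norm_sq_diagonal_le z k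
    rw [hS1] at h
    have e : (n : ℝ) * R k ^ 2 = rootChord k ^ 2 * n / rootChord (1 : ZMod n) ^ 2 := by
      simp only [hR]
      field_simp
    rw [e, le_div_iff₀ (by positivity)]
    linarith
  have htangent : ∀ s : ℝ, ∃ c : ℝ, 0 < s → 0 < c ∧ ∀ t : ℝ, 0 ≤ t → powerPotential α t ≤
      (((powerPotential α s).toReal + c * (t ^ 2 - s ^ 2) : ℝ) : EReal) := by
    intro s
    by_cases hs : 0 < s
    · obtain ⟨c, hc⟩ := (powerPotential_tangent_bound hα hs).2
      exact ⟨c, fun _ => hc⟩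
    · exact ⟨0, fun h => absurd h hs⟩
  choose c hc using htangent
  set D : ZMod n → ZMod n → ℝ := fun p q => c (R (q - p)) * (‖z q - z p‖ ^ 2 - R (q - p) ^ 2)
    with hD
  set E : ℝ := ∑ p, ∑ q ∈ Finset.Ioi p, (powerPotential α (R (ι q - ι p))).toReal with hE
  set X : ℝ := ∑ p, ∑ q ∈ Finset.Ioi p, D (ι p) (ι q) with hX
  have hne : ∀ p, ∀ q ∈ Finset.Ioi p, ι q - ι p ≠ 0 := by
    intro p q hq
    rw [sub_ne_zero]
    exact fun h => (Finset.mem_Ioi.1 hq).ne' (ι.injective h)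
  have hreg : powerEnergy α (regularPolygon n) = (E : EReal) := by
    rw [hE, EReal.coe_sum_sum_Ioi, powerEnergy]
    refine Finset.sum_congr rfl fun p _ => Finset.sum_congr rfl fun q hq => ?_
    rw [dist_regularPolygon]
    exact (powerPotential_tangent_bound hα (hRpos _ (hne p q hq))).1
  have hle : powerEnergy α A ≤ ((E + X : ℝ) : EReal) := by
    have e : E + X = ∑ p, ∑ q ∈ Finset.Ioi p,
        ((powerPotential α (R (ι q - ι p))).toReal + D (ι p) (ι q)) := by
      simp only [hE, hX, Finset.sum_add_distrib]
    rw [e, EReal.coe_sum_sum_Ioi, powerEnergy]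
    refine Finset.sum_le_sum fun p _ => Finset.sum_le_sum fun q hq => ?_
    rw [hdist]
    exact (hc _ (hRpos _ (hne p q hq))).2 _ (norm_nonneg _)
  have hXk : 2 * X = ∑ k, c (R k) * (∑ p, ‖z (p + k) - z p‖ ^ 2 - n * R k ^ 2) := by
    rw [hX, two_mul_sum_sum_Ioi]
    · have e : ∀ p, ∑ q, D (ι p) (ι q) = ∑ k, D (ι p) (ι p + k) := fun p =>
        (Equiv.sum_comp ι.toEquiv (D (ι p))).trans (Equiv.sum_comp (Equiv.addLeft (ι p)) _).symm
      simp_rw [e]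
      refine (Equiv.sum_comp ι.toEquiv fun p => ∑ k, D p (p + k)).trans ?_
      rw [Finset.sum_comm]
      refine Finset.sum_congr rfl fun k _ => ?_
      simp only [hD, add_sub_cancel_left]
      rw [← Finset.mul_sum, Finset.sum_sub_distrib]
      simp [ZMod.card]
    · intro p q
      simp only [hD]
      rw [← neg_sub (ι p), hRneg, norm_sub_rev]
    · intro p
      simp [hD, hR0]
  have hterm : ∀ k ∈ Finset.univ,
      c (R k) * (∑ p, ‖z (p + k) - z p‖ ^ 2 - n * R k ^ 2) ≤ 0 := by
    intro k _
    by_cases hk : k = 0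
    · simp [hk, hR0]
    · exact mul_nonpos_of_nonneg_of_nonpos (hc _ (hRpos k hk)).1.le (sub_nonpos.2 (hSk k))
  have hX0 : X ≤ 0 := by
    have := Finset.sum_nonpos hterm
    linarith
  refine ⟨hle.trans ?_, fun h => ?_⟩
  · rw [hreg, EReal.coe_le_coe_iff]
    linarith
  · rw [hreg] at h
    have h0 : X = 0 := le_antisymm hX0 (by linarith [EReal.coe_le_coe_iff.1 (h.trans hle)])
    rw [h0, mul_zero, eq_comm, Finset.sum_eq_zero_iff_of_nonpos hterm] at hXk
    have hk2 := (mul_eq_zero.1 (hXk 2 (Finset.mem_univ _))).resolve_left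
      (hc _ (hRpos 2 h2)).1.ne'
    have hdft := exists_eq_of_dft_eq_zero hn hedge fun j hj hj1 hj2 =>
      dft_eq_zero_of_sum_norm_sq_diagonal_eq h1 (by
        rw [hS1, sub_eq_zero.1 hk2]
        simp only [hR]
        field_simp) hj hj1 hj2
    obtain ⟨d, a, ha, hform | hform⟩ := hdft
    · exact isUnitRegularPolygon_of_eq (c := d) ha (R := LinearIsometryEquiv.refl ℝ ℂ)
        (fun _ _ => rfl) fun k => by rw [hAz, hform]; rfl
    · exact isUnitRegularPolygon_of_eq (c := d) ha (R := Complex.conjLIE)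
        (fun t x => by simp) fun k => by rw [hAz, hform]; rfl

theorem theorem5p1 (n : ℕ) (hn : 5 ≤ n) (α : ℝ) (hα : α ≤ 2) (A : Fin n → Plane) :
    (A ∈ unitConvexPolygons n ∧ IsMaxOn (powerEnergy α) (unitConvexPolygons n) A) ↔
      IsUnitRegularPolygon A := by
  constructor
  · rintro ⟨hA, hmax⟩
    have hreg : IsUnitRegularPolygon (regularPolygon n) := ⟨IsometryEquiv.refl _, fun _ => rfl⟩
    exact (powerEnergy_le_regularPolygon hn hα hA.1).2
      (hmax (mem_unitConvexPolygons_of_isUnitRegularPolygon (by omega) hreg))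
  · intro hA
    refine ⟨mem_unitConvexPolygons_of_isUnitRegularPolygon (by omega) hA, fun B hB => ?_⟩
    refine le_of_le_of_eq ?_ (powerEnergy_eq_of_isUnitRegularPolygon α hA).symm
    exact (powerEnergy_le_regularPolygon hn hα hB.1).1
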